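/- Let $G$ be a compact (Hausdorff), totally disconnected topological group and let $\alpha$ be an automorphism of the topological group $G$. Call the pair $(G,\alpha)$ irreducible if $G$ is infinite and every proper, closed, normal subgroup $H$ of $G$ that is $\alpha$-stable (that is, $\alpha(H)=H$) is finite. Then $(G,\alpha)$ is irreducible if and only if there is a finite simple group $F$ such that $(G,\alpha)$ is isomorphic to the shift $(F^{\mathbb Z},\sigma)$. Here $F$ is discrete, $F^{\mathbb Z}$ carries the coordinatewise product and the product topology, $\sigma(f)(n)=f(n+1)$ for $f\in F^{\mathbb Z}$ and $n\in\mathbb Z$, and an isomorphism from $(G,\alpha)$ to $(F^{\mathbb Z},\sigma)$ is an isomorphism of topological groups $\varphi:G\to F^{\mathbb Z}$ with $\varphi\circ\alpha=\sigma\circ\varphi$. -/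

import Mathlib

/-- The shift automorphism `σ` of the topological group `F^ℤ` (coordinatewise multiplication,
product topology), given by `σ(f)(n) = f(n + 1)`. -/
def shiftAut (F : Type*) [Group F] [TopologicalSpace F] : (ℤ → F) ≃ₜ* (ℤ → F) where
  toFun f := fun n => f (n + 1)
  invFun f := fun n => f (n - 1)
  left_inv f := by
    funext n
    simp
  right_inv f := by
    funext n
    simp
  map_mul' _ _ := rfl
  continuous_toFun := continuous_pi fun n => continuous_apply (n + 1)
  continuous_invFun := continuous_pi fun n => continuous_apply (n - 1)

/-- A subgroup `H` of `G` is `α`-stable if `α(H) = H`. -/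
def IsStableSubgroup {G : Type*} [Group G] [TopologicalSpace G]
    (α : G ≃ₜ* G) (H : Subgroup G) : Prop :=
  α '' (H : Set G) = (H : Set G)

/-- The pair `(G, α)` is irreducible if `G` is infinite and every proper, closed, normal,
`α`-stable subgroup of `G` is finite. -/
def IsIrreduciblePair {G : Type*} [Group G] [TopologicalSpace G] (α : G ≃ₜ* G) : Prop :=
  Infinite G ∧
    ∀ H : Subgroup G, H ≠ ⊤ → IsClosed (H : Set G) → H.Normal → IsStableSubgroup α H →
      (H : Set G).Finite

/-- The pairs `(G, α)` and `(H, β)` are isomorphic if there is an isomorphism of topological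
groups `G → H` that intertwines `α` and `β`. -/
def PairIso {G H : Type*} [Group G] [TopologicalSpace G] [Group H] [TopologicalSpace H]
    (α : G ≃ₜ* G) (β : H ≃ₜ* H) : Prop :=
  ∃ φ : G ≃ₜ* H, ∀ x : G, φ (α x) = β (φ x)

/-! For the shift, a proper closed normal stable subgroup fails to project onto some finite window
of coordinates. In a shortest such window of length `l + 1`, simplicity of `F` forces `l`
consecutive coordinates to determine both neighbours, hence everything, so the subgroup embeds in `F
^ l` (`finite_of_proper_of_stable`).

Conversely, irreducibility yields an open normal `N` such that `x` is determined by its coordinates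
`(a ^ n) x` modulo `N` (`exists_expansive_openNormal`). Pasts and futures can be spliced
(`exists_past_mul_mem_future`), so there are nontrivial elements with finite support
(`exists_window_ne_bot`). Take the least support length `l + 1` and a minimal normal subgroup `D` of
`G` among elements supported in `[0, l]`. Two products of translates of `D`, one from positions `<
m` and one from positions `≥ m`, overlap in only `l` coordinates, so the translates are independent;
by irreducibility they generate `G` topologically. Hence `D` is a finite simple direct factor, and
projecting the orbit of `x` to `D` identifies `G` with `D ^ ℤ`. -/

/-! ### Irreducibility of the shift over a finite simple group. -/

section Shift

variable {F : Type*} [Group F]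

/-- If a normal subgroup of `F ^ ℤ`, with `F` simple, projects onto `F ^ J` but not onto
`F ^ (J ∪ {c})`, then the coordinates in `J` determine the coordinate `c`. -/
lemma apply_eq_one_of_eqOn_one [IsSimpleGroup F] {H : Subgroup (ℤ → F)} [H.Normal] {J : Set ℤ}
    {c : ℤ} (hJ : ∀ g : ℤ → F, ∃ h ∈ H, ∀ i ∈ J, h i = g i)
    (hJc : ∃ g : ℤ → F, ∀ h ∈ H, (∀ i ∈ J, h i = g i) → h c ≠ g c)
    {h : ℤ → F} (hh : h ∈ H) (hhJ : ∀ i ∈ J, h i = 1) : h c = 1 := by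
  classical
  let K : Subgroup F :=
    { carrier := {f | ∃ h ∈ H, (∀ i ∈ J, h i = 1) ∧ h c = f}
      one_mem' := ⟨1, H.one_mem, fun _ _ => rfl, rfl⟩
      mul_mem' := by
        rintro _ _ ⟨x, hx, hx1, rfl⟩ ⟨y, hy, hy1, rfl⟩
        exact ⟨x * y, H.mul_mem hx hy, fun i hi => by simp [hx1 i hi, hy1 i hi], rfl⟩
      inv_mem' := by
        rintro _ ⟨x, hx, hx1, rfl⟩
        exact ⟨x⁻¹, H.inv_mem hx, fun i hi => by simp [hx1 i hi], rfl⟩ }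
  -- Conjugating by constant sequences realises every conjugation at coordinate `c`.
  have hKn : K.Normal := ⟨by
    rintro _ ⟨x, hx, hx1, rfl⟩ g
    refine ⟨(fun _ => g) * x * (fun _ => g)⁻¹, Subgroup.Normal.conj_mem ‹_› x hx _, ?_, rfl⟩
    intro i hi
    simp [hx1 i hi]⟩
  rcases hKn.eq_bot_or_eq_top with hK | hK
  · have : h c ∈ K := ⟨h, hh, hhJ, rfl⟩
    simpa [hK] using this
  · exfalso
    obtain ⟨g, hg⟩ := hJc
    obtain ⟨x, hx, hx1⟩ := hJ g
    have hm : (x c)⁻¹ * g c ∈ K := hK ▸ Subgroup.mem_top _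
    obtain ⟨y, hy, hy1, hyc⟩ := hm
    refine hg (x * y) (H.mul_mem hx hy) (fun i hi => ?_) ?_
    · simp [hx1 i hi, hy1 i hi]
    · simp [hyc]

variable [TopologicalSpace F]

lemma shift_mem_of_stable {H : Subgroup (ℤ → F)} (hH : IsStableSubgroup (shiftAut F) H) (m : ℤ)
    {x : ℤ → F} (hx : x ∈ H) : (fun n => x (n + m)) ∈ H := by
  induction m using Int.induction_on with
  | zero => simpa using hx
  | succ i ih =>
    have h : shiftAut F (fun n => x (n + i)) ∈ (H : Set (ℤ → F)) := by
      rw [← hH]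
      exact ⟨_, ih, rfl⟩
    refine (congrArg (· ∈ H) ?_).mpr h
    funext n
    change _ = x (n + 1 + i)
    congr 1
    ring
  | pred i ih =>
    have h : (fun n => x (n + -(i : ℤ))) ∈ (H : Set (ℤ → F)) := ih
    rw [← hH] at h
    obtain ⟨y, hy, hyx⟩ := h
    refine (congrArg (· ∈ H) ?_).mpr hy
    funext n
    have h2 := congrFun hyx (n - 1)
    change y (n - 1 + 1) = x (n - 1 + -i) at h2
    rw [sub_add_cancel] at h2
    rw [h2]
    congr 1
    ring

/-- A shortest window onto which `H` does not project has length `l + 1`; its first `l` coordinates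
determine the last, its last `l` determine the first, and stability propagates this over all of `ℤ`.
-/
lemma finite_of_proper_of_stable [Finite F] [IsSimpleGroup F] [DiscreteTopology F]
    {H : Subgroup (ℤ → F)} (hne : H ≠ ⊤) (hcl : IsClosed (H : Set (ℤ → F))) (hn : H.Normal)
    (hst : IsStableSubgroup (shiftAut F) H) : (H : Set (ℤ → F)).Finite := by
  classical
  -- Otherwise `H` would be dense: every finite set of coordinates lies in some `[-B, B)`, which a
  -- shift moves to `[0, 2 * B)`.
  have hex : ∃ l : ℕ, ¬ ∀ g : ℤ → F, ∃ h ∈ H, ∀ i ∈ Set.Ico (0 : ℤ) l, h i = g i := by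
    by_contra! hcon
    refine hne (eq_top_iff.2 fun g _ => ?_)
    rw [← SetLike.mem_coe, ← hcl.closure_eq, mem_closure_iff]
    intro U hU hgU
    obtain ⟨I, u, hu, hIU⟩ := isOpen_pi_iff.1 hU g hgU
    obtain ⟨B, hB⟩ : ∃ B : ℕ, ∀ i ∈ I, -(B : ℤ) ≤ i ∧ i < B := by
      refine ⟨I.sup Int.natAbs + 1, fun i hi => ?_⟩
      have := Finset.le_sup (f := Int.natAbs) hi
      omega
    obtain ⟨h, hh, hhg⟩ := hcon (2 * B) (fun n => g (n + -B))
    refine ⟨_, hIU fun i hi => ?_, shift_mem_of_stable hst B hh⟩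
    obtain ⟨h1, h2⟩ := hB i hi
    have h3 := hhg (i + B) ⟨by omega, by push_cast; omega⟩
    simp only [add_neg_cancel_right] at h3
    simp only [h3]
    exact (hu i hi).2
  have hspec := Nat.find_spec hex
  have hmin := fun m => Nat.find_min (H := hex) (m := m)
  generalize Nat.find hex = l at hspec hmin
  obtain _ | l := l
  · exact absurd (fun g => ⟨1, H.one_mem, fun i hi => by simp at hi⟩) hspec
  have hl := not_not.1 (hmin l (Nat.lt_succ_self l))
  push Not at hspec
  obtain ⟨g, hg⟩ := hspec
  have hright : ∀ h ∈ H, (∀ i ∈ Set.Ico (0 : ℤ) l, h i = 1) → h l = 1 := by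
    intro h hh h1
    refine apply_eq_one_of_eqOn_one hl ⟨g, fun x hx hxg hc => ?_⟩ hh h1
    obtain ⟨i, hi, hne⟩ := hg x hx
    simp only [Set.mem_Ico] at hi hxg
    by_cases hil : i = l
    · exact hne (hil ▸ hc)
    · exact hne (hxg i ⟨by omega, by push_cast at hi; omega⟩)
  have hleft : ∀ h ∈ H, (∀ i ∈ Set.Ico (1 : ℤ) (l + 1), h i = 1) → h 0 = 1 := by
    intro h hh h1
    refine apply_eq_one_of_eqOn_one (J := Set.Ico (1 : ℤ) (l + 1)) (fun g' => ?_)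
      ⟨g, fun x hx hxg hc => ?_⟩ hh h1
    · obtain ⟨x, hx, hxg⟩ := hl (fun n => g' (n + 1))
      refine ⟨_, shift_mem_of_stable hst (-1) hx, fun i hi => ?_⟩
      simp only [Set.mem_Ico] at hi
      simpa using hxg (i + -1) ⟨by omega, by omega⟩
    · obtain ⟨i, hi, hne⟩ := hg x hx
      simp only [Set.mem_Ico] at hi hxg
      by_cases hil : i = 0
      · exact hne (hil ▸ hc)
      · exact hne (hxg i ⟨by omega, by push_cast at hi; omega⟩)
  have hall : ∀ h ∈ H, (∀ i ∈ Set.Ico (0 : ℤ) l, h i = 1) → h = 1 := by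
    intro h hh h1
    -- The interval of trivial coordinates grows by one on each side.
    have key : ∀ n : ℕ, ∀ i ∈ Set.Ico (-n : ℤ) (l + n), h i = 1 := by
      intro n
      induction n with
      | zero => simpa using h1
      | succ n ih =>
        intro i hi
        simp only [Set.mem_Ico] at hi ih
        push_cast at hi
        rcases lt_trichotomy i (-n : ℤ) with h2 | h2 | h2
        · have := hleft _ (shift_mem_of_stable hst i hh) fun j hj => ih _ (by
            simp only [Set.mem_Ico] at hj
            omega)
          simpa using this
        · by_cases h3 : i < l + n
          · exact ih i ⟨by omega, by omega⟩
          · have := hright _ (shift_mem_of_stable hst (i - l) hh) fun j hj => ih _ (by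
              simp only [Set.mem_Ico] at hj
              omega)
            simpa using this
        · by_cases h3 : i < l + n
          · exact ih i ⟨by omega, by omega⟩
          · have := hright _ (shift_mem_of_stable hst (i - l) hh) fun j hj => ih _ (by
              simp only [Set.mem_Ico] at hj
              omega)
            simpa using this
    funext i
    exact key (i.natAbs + 1) i ⟨by omega, by omega⟩
  have hinj : Function.Injective fun (h : H) (i : Set.Ico (0 : ℤ) l) => (h : ℤ → F) i := by
    intro x y hxy
    have h1 := hall _ (H.mul_mem x.2 (H.inv_mem y.2)) fun i hi => by
      have : (x : ℤ → F) i = (y : ℤ → F) i := congrFun hxy ⟨i, hi⟩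
      simp [this]
    exact Subtype.ext (mul_inv_eq_one.1 h1)
  have : Finite H := Finite.of_injective _ hinj
  exact Set.toFinite _

lemma isIrreduciblePair_shiftAut [Finite F] [IsSimpleGroup F] [DiscreteTopology F] :
    IsIrreduciblePair (shiftAut F) :=
  ⟨inferInstance, fun _ hne hcl hn hst => finite_of_proper_of_stable hne hcl hn hst⟩

lemma IsIrreduciblePair.of_pairIso {G G' : Type*} [Group G] [TopologicalSpace G] [Group G']
    [TopologicalSpace G'] {α : G ≃ₜ* G} {β : G' ≃ₜ* G'} (hβ : IsIrreduciblePair β)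
    (h : PairIso α β) : IsIrreduciblePair α := by
  obtain ⟨φ, hφ⟩ := h
  obtain ⟨hinf, hβ⟩ := hβ
  refine ⟨(Equiv.infinite_iff φ.toEquiv).2 hinf, fun H hne hcl hn hst => ?_⟩
  have himg : ((H.map φ.toMulEquiv.toMonoidHom : Subgroup G') : Set G') = φ '' H := rfl
  have hfin := hβ (H.map φ.toMulEquiv.toMonoidHom) (fun htop => hne ?_) ?_
    (hn.map _ φ.surjective) ?_
  · rw [himg] at hfin
    exact hfin.of_finite_image φ.injective.injOn
  · exact eq_top_iff.2 fun x _ => by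
      have : φ x ∈ ((H.map φ.toMulEquiv.toMonoidHom : Subgroup G') : Set G') := by
        rw [htop]; trivial
      rw [himg] at this
      exact (φ.injective.mem_set_image).1 this
  · rw [himg]
    exact φ.toHomeomorph.isClosedMap _ hcl
  · unfold IsStableSubgroup at hst ⊢
    rw [himg]
    conv_rhs => rw [← hst]
    simp only [Set.image_image, hφ]

end Shift

/-- A decreasing sequence of nonempty closed subsets of a compact space has a common point. -/
lemma exists_forall_mem_of_antitone {X : Type*} [TopologicalSpace X] [CompactSpace X]
    (C : ℕ → Set X) (hC : Antitone C)
    (hne : ∀ n, (C n).Nonempty) (hcl : ∀ n, IsClosed (C n)) : ∃ x, ∀ n, x ∈ C n := by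
  obtain ⟨x, hx⟩ := IsCompact.nonempty_iInter_of_sequence_nonempty_isCompact_isClosed C
    (fun n => hC (Nat.le_succ n)) hne (hcl 0).isCompact hcl
  exact ⟨x, fun n => Set.mem_iInter.1 hx n⟩

/-! ### Coordinates modulo `N`: splicing and one-sided supports. -/

section Window

variable {G : Type*} [Group G]

/-- The elements `x` such that `a ^ n` sends `x` into `N` for all `n ∈ S`. -/
def window (a : MulAut G) (N : Subgroup G) (S : Set ℤ) : Subgroup G :=
  ⨅ n ∈ S, N.comap (a ^ n).toMonoidHom

variable {a : MulAut G} {N : Subgroup G}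

lemma mem_window {S : Set ℤ} {x : G} : x ∈ window a N S ↔ ∀ n ∈ S, (a ^ n) x ∈ N := by
  simp [window, Subgroup.mem_iInf]

lemma zpow_add_aut_apply (a : MulAut G) (m n : ℤ) (x : G) :
    (a ^ (m + n)) x = (a ^ m) ((a ^ n) x) := by
  rw [zpow_add]; rfl

lemma window_anti {S T : Set ℤ} (h : S ⊆ T) : window a N T ≤ window a N S :=
  fun _ hx => mem_window.2 fun n hn => mem_window.1 hx n (h hn)

lemma zpow_mem_window {S T : Set ℤ} {m : ℤ} {x : G} (hx : x ∈ window a N S)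
    (hST : ∀ n ∈ T, n + m ∈ S) : (a ^ m) x ∈ window a N T :=
  mem_window.2 fun n hn => by
    rw [← zpow_add_aut_apply]
    exact mem_window.1 hx _ (hST n hn)

lemma zpow_neg_zpow_apply (a : MulAut G) (m : ℤ) (x : G) : (a ^ (-m)) ((a ^ m) x) = x := by
  rw [← zpow_add_aut_apply]; simp

lemma zpow_zpow_neg_apply (a : MulAut G) (m : ℤ) (x : G) : (a ^ m) ((a ^ (-m)) x) = x := by
  rw [← zpow_add_aut_apply]; simp

lemma window_eq_bot_of_shift {S T : Set ℤ} (m : ℤ) (hS : window a N S = ⊥)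
    (h : ∀ n ∈ S, n + m ∈ T) : window a N T = ⊥ := by
  refine (Subgroup.eq_bot_iff_forall _).2 fun x hx => ?_
  have := zpow_mem_window hx h
  rw [hS, Subgroup.mem_bot] at this
  simpa using this

lemma window_normal [hN : N.Normal] (S : Set ℤ) : (window a N S).Normal :=
  ⟨fun x hx g => mem_window.2 fun n hn => by
    rw [map_mul, map_mul, map_inv]
    exact hN.conj_mem _ (mem_window.1 hx n hn) _⟩

lemma window_inv (S : Set ℤ) : window a⁻¹ N S = window a N (-S) := by
  ext x
  simp only [mem_window, inv_zpow']
  exact ⟨fun h n hn => by simpa using h (-n) hn, fun h n hn => h (-n) (by simpa using hn)⟩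

lemma zpow_mem_iff_of_stable {H : Subgroup G} (hH : ∀ x, a x ∈ H ↔ x ∈ H) (n : ℤ) (x : G) :
    (a ^ n) x ∈ H ↔ x ∈ H := by
  induction n using Int.induction_on with
  | zero => simp
  | succ i ih => rw [add_comm, zpow_add_aut_apply, zpow_one, hH, ih]
  | pred i ih =>
    have h : (a ^ (-i : ℤ)) x = a ((a ^ (-i - 1 : ℤ)) x) := by
      conv_lhs => rw [show (-i : ℤ) = 1 + (-i - 1) by ring, zpow_add_aut_apply, zpow_one]
    rw [← ih, h, hH]

variable [TopologicalSpace G]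

lemma window_isClosed (ha : ∀ n : ℤ, Continuous (a ^ n)) (hN : IsClosed (N : Set G)) (S : Set ℤ) :
    IsClosed (window a N S : Set G) := by
  have : (window a N S : Set G) = ⋂ n ∈ S, (a ^ n) ⁻¹' N := by
    ext x; simp [mem_window]
  rw [this]
  exact isClosed_biInter fun n _ => hN.preimage (ha n)

lemma window_isOpen (ha : ∀ n : ℤ, Continuous (a ^ n)) (hN : IsOpen (N : Set G)) {S : Set ℤ}
    (hS : S.Finite) : IsOpen (window a N S : Set G) := by
  have : (window a N S : Set G) = ⋂ n ∈ S, (a ^ n) ⁻¹' N := by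
    ext x; simp [mem_window]
  rw [this]
  exact hS.isOpen_biInter fun n _ => hN.preimage (ha n)

lemma stable_topologicalClosure [IsTopologicalGroup G] (ha : ∀ n : ℤ, Continuous (a ^ n))
    {H : Subgroup G} (hH : ∀ x, a x ∈ H ↔ x ∈ H) (x : G) :
    a x ∈ H.topologicalClosure ↔ x ∈ H.topologicalClosure := by
  have key : ∀ n : ℤ, ∀ y ∈ H.topologicalClosure, (a ^ n) y ∈ H.topologicalClosure := by
    intro n y hy
    exact map_mem_closure (ha n) hy fun z hz => (zpow_mem_iff_of_stable hH n z).2 hz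
  refine ⟨fun h => ?_, fun h => by simpa using key 1 x h⟩
  have := key (-1) _ h
  simpa using this

variable [IsTopologicalGroup G] [CompactSpace G]

/-- The images of the windows `[-n, 0)` in the finite group `G ⧸ N` decrease, hence stabilise;
compactness gives the same image for the whole past. -/
lemma exists_past_mul_mem (ha : ∀ n : ℤ, Continuous (a ^ n)) [N.Normal]
    (hN : IsOpen (N : Set G)) : ∃ k : ℕ, ∀ x ∈ window a N (Set.Ico (-k) 0),
      ∃ y ∈ window a N (Set.Iio 0), y⁻¹ * x ∈ N := by
  have hNc : IsClosed (N : Set G) := N.isClosed_of_isOpen hN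
  have : Finite (G ⧸ N) := N.quotient_finite_of_isOpen hN
  let M : ℕ →o (Subgroup (G ⧸ N))ᵒᵈ :=
    ⟨fun n => OrderDual.toDual ((window a N (Set.Ico (-n : ℤ) 0)).map (QuotientGroup.mk' N)),
      fun m n hmn => Subgroup.map_mono (window_anti (Set.Ico_subset_Ico_left (by omega)))⟩
  obtain ⟨k, hk⟩ := WellFoundedGT.monotone_chain_condition M
  refine ⟨k, fun x hx => ?_⟩
  have hx' : ∀ n : ℕ, ∃ y ∈ window a N (Set.Ico (-n : ℤ) 0), y⁻¹ * x ∈ N := by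
    have key : ∀ n, k ≤ n → ∃ y ∈ window a N (Set.Ico (-n : ℤ) 0), y⁻¹ * x ∈ N := by
      intro n hn
      have h1 : (QuotientGroup.mk' N) x ∈
          (window a N (Set.Ico (-n : ℤ) 0)).map (QuotientGroup.mk' N) := by
        have : (window a N (Set.Ico (-k : ℤ) 0)).map (QuotientGroup.mk' N) =
          (window a N (Set.Ico (-n : ℤ) 0)).map (QuotientGroup.mk' N) := hk n hn
        rw [← this]
        exact Subgroup.mem_map_of_mem _ hx
      obtain ⟨y, hy, hyx⟩ := h1
      exact ⟨y, hy, QuotientGroup.eq.1 hyx⟩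
    intro n
    obtain ⟨y, hy, hyx⟩ := key (max k n) (le_max_left _ _)
    exact ⟨y, window_anti (Set.Ico_subset_Ico_left (by omega)) hy, hyx⟩
  obtain ⟨y, hy⟩ := exists_forall_mem_of_antitone
    (fun n : ℕ => (window a N (Set.Ico (-n : ℤ) 0) : Set G) ∩ {y | y⁻¹ * x ∈ N})
    (fun m n hmn => Set.inter_subset_inter_left _
      (window_anti (Set.Ico_subset_Ico_left (by omega))))
    (fun n => hx' n)
    (fun n => (window_isClosed ha hNc _).inter (hNc.preimage (by fun_prop)))
  refine ⟨y, mem_window.2 fun n hn => ?_, (hy 0).2⟩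
  exact mem_window.1 (hy n.natAbs).1 n ⟨by omega, hn⟩

/-- Expansive systems given by an open normal subgroup are of finite type: the past and the future
of elements agreeing on a long enough window can be spliced. -/
lemma exists_past_mul_mem_future (ha : ∀ n : ℤ, Continuous (a ^ n)) [N.Normal]
    (hN : IsOpen (N : Set G)) : ∃ k : ℕ, ∀ x ∈ window a N (Set.Ico (-k) 0),
      ∃ y ∈ window a N (Set.Iio 0), y⁻¹ * x ∈ window a N (Set.Ici 0) := by
  have hNc : IsClosed (N : Set G) := N.isClosed_of_isOpen hN
  obtain ⟨k, hk⟩ := exists_past_mul_mem ha hN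
  refine ⟨k, fun x hx => ?_⟩
  have hfin : ∀ m : ℕ, ∃ y ∈ window a N (Set.Iio 0),
      y⁻¹ * x ∈ window a N (Set.Ico (-k : ℤ) m) := by
    intro m
    induction m with
    | zero => exact ⟨1, one_mem _, by simpa using hx⟩
    | succ m ih =>
      obtain ⟨y, hy, hyx⟩ := ih
      -- The error `y⁻¹ * x` is corrected at coordinate `m` by a translate of `u`, whose coordinates
      -- before `m` are trivial, so earlier agreement survives.
      obtain ⟨u, hu, hux⟩ := hk ((a ^ (m : ℤ)) (y⁻¹ * x)) (zpow_mem_window hyx fun n hn => by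
        simp only [Set.mem_Ico] at hn ⊢
        omega)
      have hu' : (a ^ (-m : ℤ)) u ∈ window a N (Set.Iio m) :=
        zpow_mem_window hu fun n hn => by
          simp only [Set.mem_Iio] at hn ⊢
          omega
      refine ⟨y * (a ^ (-m : ℤ)) u, mul_mem hy (window_anti (Set.Iio_subset_Iio (by omega)) hu'),
        mem_window.2 fun n hn => ?_⟩
      have heq : (y * (a ^ (-m : ℤ)) u)⁻¹ * x = ((a ^ (-m : ℤ)) u)⁻¹ * (y⁻¹ * x) := by group
      rw [heq]
      by_cases hnm : n = m
      · subst hnm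
        rw [map_mul, map_inv, zpow_zpow_neg_apply]
        exact hux
      · simp only [Set.mem_Ico] at hn
        push_cast at hn
        rw [map_mul, map_inv]
        exact mul_mem (inv_mem (mem_window.1 hu' n (by simp only [Set.mem_Iio]; omega)))
          (mem_window.1 hyx n ⟨by omega, by omega⟩)
  obtain ⟨y, hy⟩ := exists_forall_mem_of_antitone
    (fun m : ℕ => (window a N (Set.Iio 0) : Set G) ∩ {y | y⁻¹ * x ∈ window a N (Set.Ico (-k : ℤ) m)})
    (fun m n hmn => Set.inter_subset_inter_right _ fun y hy =>
      window_anti (Set.Ico_subset_Ico_right (by omega)) hy)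
    hfin
    (fun n => (window_isClosed ha hNc _).inter
      ((window_isClosed ha hNc _).preimage (by fun_prop)))
  refine ⟨y, (hy 0).1, mem_window.2 fun n hn => ?_⟩
  simp only [Set.mem_Ici] at hn
  exact mem_window.1 (hy (n.natAbs + 1)).2 n ⟨by omega, by omega⟩

/-- If it were trivial, then by compactness finitely many coordinates `[0, k)` would force
coordinate `-1`. The open window on `[0, k)` would then be mapped into itself by `a⁻¹`, hence onto
itself since the index is preserved; being stable, it would be trivial by expansiveness, making `G`
finite. -/
lemma window_Ici_ne_bot [Infinite G] (ha : ∀ n : ℤ, Continuous (a ^ n))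
    (hN : IsOpen (N : Set G)) (hexp : window a N Set.univ = ⊥) :
    window a N (Set.Ici 0) ≠ ⊥ := by
  have hNc : IsClosed (N : Set G) := N.isClosed_of_isOpen hN
  intro hbot
  obtain ⟨k, hk⟩ : ∃ k : ℕ, ∀ x ∈ window a N (Set.Ico 0 k), (a ^ (-1 : ℤ)) x ∈ N := by
    by_contra! hcon
    obtain ⟨x, hx⟩ := exists_forall_mem_of_antitone
      (fun k : ℕ => (window a N (Set.Ico 0 k) : Set G) ∩ {x | (a ^ (-1 : ℤ)) x ∉ N})
      (fun m n hmn => Set.inter_subset_inter_left _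
        (window_anti (Set.Ico_subset_Ico_right (by omega))))
      hcon
      (fun n => (window_isClosed ha hNc _).inter
        (hN.isClosed_compl.preimage (ha (-1))))
    have : x ∈ window a N (Set.Ici 0) := mem_window.2 fun n hn => by
      simp only [Set.mem_Ici] at hn
      exact mem_window.1 (hx (n.natAbs + 1)).1 n ⟨by omega, by omega⟩
    rw [hbot, Subgroup.mem_bot] at this
    exact (hx 0).2 (by simp [this])
  have hV := window_isOpen ha hN (Set.finite_Ico (0 : ℤ) k)
  have : Finite (G ⧸ window a N (Set.Ico (0 : ℤ) k)) := Subgroup.quotient_finite_of_isOpen _ hV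
  have hVi : (window a N (Set.Ico (0 : ℤ) k)).index ≠ 0 := Subgroup.index_ne_zero_of_finite
  have hle : (window a N (Set.Ico (0 : ℤ) k)) ≤
      (window a N (Set.Ico (0 : ℤ) k)).comap (a⁻¹).toMonoidHom := by
    intro x hx
    rw [Subgroup.mem_comap]
    refine mem_window.2 fun n hn => ?_
    have : (a ^ n) ((a⁻¹) x) = (a ^ (n + -1)) x := by
      rw [zpow_add_aut_apply]; simp
    change (a ^ n) ((a⁻¹) x) ∈ N
    rw [this]
    simp only [Set.mem_Ico] at hn
    by_cases h0 : n = 0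
    · subst h0
      simpa using hk x hx
    · exact mem_window.1 hx _ ⟨by omega, by omega⟩
  have heq : (window a N (Set.Ico (0 : ℤ) k)) =
      (window a N (Set.Ico (0 : ℤ) k)).comap (a⁻¹).toMonoidHom := by
    by_contra hne
    have : (window a N (Set.Ico (0 : ℤ) k)).FiniteIndex := ⟨hVi⟩
    have := Subgroup.index_strictAnti (lt_of_le_of_ne hle hne)
    rw [Subgroup.index_comap_of_surjective _ (a⁻¹).surjective] at this
    exact lt_irrefl _ this
  have hst : ∀ x, a x ∈ window a N (Set.Ico (0 : ℤ) k) ↔ x ∈ window a N (Set.Ico (0 : ℤ) k) := by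
    intro x
    conv_lhs => rw [heq]
    rw [Subgroup.mem_comap]
    simp
  have hbot' : window a N (Set.Ico (0 : ℤ) k) = ⊥ := by
    rw [eq_bot_iff, ← hexp]
    intro x hx
    refine mem_window.2 fun n _ => ?_
    have h1 := hk _ ((zpow_mem_iff_of_stable hst (n + 1) x).2 hx)
    rwa [← zpow_add_aut_apply, show -1 + (n + 1) = n by ring] at h1
  rw [hbot', Subgroup.index_bot, Nat.card_eq_zero_of_infinite] at hVi
  exact hVi rfl

lemma window_Iio_ne_bot [Infinite G] (ha : ∀ n : ℤ, Continuous (a ^ n))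
    (hN : IsOpen (N : Set G)) (hexp : window a N Set.univ = ⊥) :
    window a N (Set.Iio 0) ≠ ⊥ := by
  have h := window_Ici_ne_bot (a := a⁻¹) (fun n => by rw [inv_zpow']; exact ha _) hN
    (by rw [window_inv, Set.neg_univ]; exact hexp)
  rw [window_inv] at h
  refine fun hbot => h (window_eq_bot_of_shift 1 hbot fun n hn => ?_)
  simp only [Set.mem_Iio, Set.mem_neg, Set.mem_Ici] at hn ⊢
  omega

end Window

/-! ### Expansiveness and finitely supported elements. -/

section Homoclinic

variable {G : Type*} [Group G] [TopologicalSpace G] [IsTopologicalGroup G] [CompactSpace G]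
  {a : MulAut G} {N : Subgroup G}

/-- For an open normal `M ≠ ⊤`, the elements whose whole orbit stays in `M` form a finite subgroup
by irreducibility; a second open normal subgroup `M'` excludes its nontrivial elements. -/
lemma exists_expansive_openNormal [TotallyDisconnectedSpace G] [T2Space G] [Infinite G]
    (ha : ∀ n : ℤ, Continuous (a ^ n))
    (hirr : ∀ H : Subgroup G, H ≠ ⊤ → IsClosed (H : Set G) → H.Normal →
      (∀ x, a x ∈ H ↔ x ∈ H) → (H : Set G).Finite) :
    ∃ N : Subgroup G, N.Normal ∧ IsOpen (N : Set G) ∧ window a N Set.univ = ⊥ := by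
  obtain ⟨x, hx⟩ := exists_ne (1 : G)
  obtain ⟨M, hM⟩ := ProfiniteGrp.exist_openNormalSubgroup_sub_open_nhds_of_one
    (isOpen_compl_singleton (x := x)) (by simpa using hx.symm)
  have hMo : IsOpen ((M : Subgroup G) : Set G) := M.isOpen'
  have hMc := (M : Subgroup G).isClosed_of_isOpen hMo
  have hMx : x ∉ (M : Subgroup G) := fun h => hM h rfl
  have hfin := hirr (window a M Set.univ) (fun htop => hMx (by
      have : x ∈ window a (M : Subgroup G) Set.univ := htop ▸ Subgroup.mem_top x
      simpa using mem_window.1 this 0 trivial))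
    (window_isClosed ha hMc _) (window_normal _) (fun x => ⟨fun h => by
      simpa using zpow_mem_window (T := Set.univ) (m := -1) h (by simp), fun h => by
      simpa using zpow_mem_window (T := Set.univ) (m := 1) h (by simp)⟩)
  obtain ⟨M', hM'⟩ := ProfiniteGrp.exist_openNormalSubgroup_sub_open_nhds_of_one
    (U := ((window a (M : Subgroup G) Set.univ : Set G) \ {1})ᶜ)
    (hfin.subset Set.sdiff_subset).isClosed.isOpen_compl (by simp)
  refine ⟨(M : Subgroup G) ⊓ (M' : Subgroup G), inferInstance, hMo.inter M'.isOpen', ?_⟩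
  refine (Subgroup.eq_bot_iff_forall _).2 fun y hy => ?_
  by_contra hy1
  have h0 : y ∈ (M' : Subgroup G) := by simpa using (mem_window.1 hy 0 trivial).2
  exact hM' h0 ⟨mem_window.2 fun n hn => (mem_window.1 hy n hn).1, hy1⟩

omit [TopologicalSpace G] [IsTopologicalGroup G] [CompactSpace G] in
/-- An infinite orbit: a stable subgroup with a nontrivial element whose forward orbit eventually
stays in `N` is infinite. -/
lemma not_finite_of_mem_window_Ici (hexp : window a N Set.univ = ⊥) {H : Subgroup G}
    (hH : ∀ x, a x ∈ H ↔ x ∈ H) {x : G} (hx : x ∈ H) (hx1 : x ≠ 1) {m : ℤ}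
    (hm : x ∈ window a N (Set.Ici m)) : ¬ (H : Set G).Finite := by
  intro hfin
  have : Finite H := hfin
  obtain ⟨i, j, hij, hxe⟩ := Finite.exists_ne_map_eq_of_infinite
    fun n : ℕ => (⟨(a ^ (n : ℤ)) x, (zpow_mem_iff_of_stable hH n x).2 hx⟩ : H)
  replace hxe : (a ^ (i : ℤ)) x = (a ^ (j : ℤ)) x := congrArg Subtype.val hxe
  wlog hlt : i < j generalizing i j
  · exact this j i hij.symm hxe.symm (by omega)
  have hper : (a ^ ((j : ℤ) - i)) x = x := by
    rw [sub_eq_add_neg, add_comm, zpow_add_aut_apply, ← hxe, zpow_neg_zpow_apply]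
  have hper' : ∀ t : ℕ, (a ^ (((j : ℤ) - i) * t)) x = x := by
    intro t
    induction t with
    | zero => simp
    | succ t ih =>
      rw [show ((j : ℤ) - i) * ((t + 1 : ℕ) : ℤ) = ((j : ℤ) - i) * t + ((j : ℤ) - i) by
        push_cast; ring, zpow_add_aut_apply, hper, ih]
  -- By periodicity, coordinate `n` equals one beyond `m`, which is trivial.
  refine hx1 ((Subgroup.eq_bot_iff_forall _).1 hexp x (mem_window.2 fun n _ => ?_))
  have h := mem_window.1 hm (n + ((j : ℤ) - i) * (m - n).natAbs) (by
    have h1 : (1 : ℤ) * ((m - n).natAbs : ℤ) ≤ ((j : ℤ) - i) * (m - n).natAbs :=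
      mul_le_mul_of_nonneg_right (by omega) (by omega)
    simp only [Set.mem_Ici]
    omega)
  rwa [zpow_add_aut_apply, hper'] at h

/-- The elements whose forward orbit eventually stays in `N`. -/
def eventualWindow (a : MulAut G) (N : Subgroup G) : Subgroup G where
  carrier := {x | ∃ m : ℤ, x ∈ window a N (Set.Ici m)}
  one_mem' := ⟨0, one_mem _⟩
  mul_mem' := by
    rintro x y ⟨m, hm⟩ ⟨n, hn⟩
    exact ⟨max m n, mul_mem (window_anti (Set.Ici_subset_Ici.2 (le_max_left _ _)) hm)
      (window_anti (Set.Ici_subset_Ici.2 (le_max_right _ _)) hn)⟩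
  inv_mem' := by
    rintro x ⟨m, hm⟩
    exact ⟨m, inv_mem hm⟩

/-- Elements with eventually trivial future are dense. An `x` with trivial past is followed until
after a nontrivial coordinate `j`, then spliced into such an element `y`. -/
lemma exists_window_ne_bot [Infinite G] (ha : ∀ n : ℤ, Continuous (a ^ n)) [N.Normal]
    (hN : IsOpen (N : Set G)) (hexp : window a N Set.univ = ⊥)
    (hfull : ∀ H : Subgroup G, IsClosed (H : Set G) → H.Normal → (∀ x, a x ∈ H ↔ x ∈ H) →
      ∀ x ∈ H, x ≠ 1 → ∀ m, x ∈ window a N (Set.Ici m) → H = ⊤) :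
    ∃ k : ℕ, window a N (Set.Iio 0 ∪ Set.Ici (k : ℤ)) ≠ ⊥ := by
  have hnorm : (eventualWindow a N).Normal := ⟨by
    rintro x ⟨m, hm⟩ g
    exact ⟨m, (window_normal _).conj_mem x hm g⟩⟩
  have hst : ∀ x, a x ∈ eventualWindow a N ↔ x ∈ eventualWindow a N := by
    refine fun x => ⟨fun ⟨m, hm⟩ => ⟨m + 1, ?_⟩, fun ⟨m, hm⟩ => ⟨m - 1, ?_⟩⟩
    · have := zpow_mem_window (m := -1) (T := Set.Ici (m + 1)) hm fun n hn => by
        simp only [Set.mem_Ici] at hn ⊢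
        omega
      simpa using this
    · have := zpow_mem_window (m := 1) (T := Set.Ici (m - 1)) hm fun n hn => by
        simp only [Set.mem_Ici] at hn ⊢
        omega
      simpa using this
  obtain ⟨p, hp, hp1⟩ :=
    (Subgroup.bot_or_exists_ne_one _).resolve_left (window_Ici_ne_bot ha hN hexp)
  have hdense : (eventualWindow a N).topologicalClosure = ⊤ :=
    hfull _ (Subgroup.isClosed_topologicalClosure _) (Subgroup.is_normal_topologicalClosure _)
      (stable_topologicalClosure ha hst) p (Subgroup.le_topologicalClosure _ ⟨0, hp⟩) hp1 0 hp
  obtain ⟨x, hx, hx1⟩ :=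
    (Subgroup.bot_or_exists_ne_one _).resolve_left (window_Iio_ne_bot ha hN hexp)
  obtain ⟨j, hj⟩ : ∃ j : ℤ, (a ^ j) x ∉ N := by
    by_contra! hcon
    exact hx1 ((Subgroup.eq_bot_iff_forall _).1 hexp x (mem_window.2 fun n _ => hcon n))
  have hj0 : 0 ≤ j := by
    by_contra hlt
    exact hj (mem_window.1 hx j (by simpa using hlt))
  obtain ⟨k, hk⟩ := exists_past_mul_mem_future ha hN
  -- The overlap has the splicing length `k` and starts after `j`, so the correction `w` found below
  -- leaves coordinate `j` of `x` unchanged modulo `N`.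
  obtain ⟨y, hyo, m, hy⟩ : ∃ y : G, x⁻¹ * y ∈ window a N (Set.Ico (j + 1) (j + 1 + k)) ∧
      y ∈ eventualWindow a N := by
    have hmem : x ∈ closure (eventualWindow a N : Set G) := by
      rw [← Subgroup.topologicalClosure_coe, hdense]; trivial
    obtain ⟨y, hy1, hy2⟩ := mem_closure_iff.1 hmem
      {y | x⁻¹ * y ∈ window a N (Set.Ico (j + 1) (j + 1 + k))}
      ((window_isOpen ha hN (Set.finite_Ico _ _)).preimage (by fun_prop)) (by simp)
    exact ⟨y, hy1, hy2⟩
  obtain ⟨u, hu, huv⟩ := hk _ (zpow_mem_window (m := j + 1 + k) hyo fun n hn => by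
    simp only [Set.mem_Ico] at hn ⊢
    omega)
  have hu' : (a ^ (-(j + 1 + k))) u ∈ window a N (Set.Iio (j + 1 + k)) :=
    zpow_mem_window hu fun n hn => by
      simp only [Set.mem_Iio] at hn ⊢
      omega
  have hv' : ((a ^ (-(j + 1 + k))) u)⁻¹ * (x⁻¹ * y) ∈ window a N (Set.Ici (j + 1 + k)) := by
    have := zpow_mem_window (m := -(j + 1 + k)) (T := Set.Ici (j + 1 + k)) huv fun n hn => by
      simp only [Set.mem_Ici] at hn ⊢
      omega
    rwa [map_mul, map_inv, zpow_neg_zpow_apply] at this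
  set w := (a ^ (-(j + 1 + k))) u with hw
  refine ⟨(max m (j + 1 + k)).toNat, fun hbot => hj ?_⟩
  have hz : x * w ∈ window a N (Set.Iio 0 ∪ Set.Ici ((max m (j + 1 + k)).toNat : ℤ)) := by
    refine mem_window.2 fun n hn => ?_
    rcases hn with hn | hn
    · simp only [Set.mem_Iio] at hn
      rw [map_mul]
      exact mul_mem (mem_window.1 hx n hn)
        (mem_window.1 hu' n (by simp only [Set.mem_Iio]; omega))
    · simp only [Set.mem_Ici] at hn
      -- Seen from the right, the spliced element is `y` times a factor with trivial future.
      rw [show x * w = y * (w⁻¹ * (x⁻¹ * y))⁻¹ by group, map_mul, map_inv]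
      exact mul_mem (mem_window.1 hy n (by simp only [Set.mem_Ici]; omega))
        (inv_mem (mem_window.1 hv' n (by simp only [Set.mem_Ici]; omega)))
  rw [hbot, Subgroup.mem_bot] at hz
  rw [eq_inv_of_mul_eq_one_left hz, map_inv]
  exact inv_mem (mem_window.1 hu' j (by simp only [Set.mem_Iio]; omega))

end Homoclinic

/-! ### Independence of the translates of a finite normal subgroup. -/

section Block

variable {G : Type*} [Group G] {a : MulAut G} {N D : Subgroup G}

/-- The translate of `D` at position `j`. -/
def shiftSubgroup (a : MulAut G) (D : Subgroup G) (j : ℤ) : Subgroup G :=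
  D.comap (a ^ j).toMonoidHom

lemma mem_shiftSubgroup {j : ℤ} {x : G} : x ∈ shiftSubgroup a D j ↔ (a ^ j) x ∈ D := Iff.rfl

instance shiftSubgroup_normal [hD : D.Normal] (j : ℤ) : (shiftSubgroup a D j).Normal := hD.comap _

instance shiftSubgroup_finite [Finite D] (j : ℤ) : Finite (shiftSubgroup a D j) :=
  Finite.of_injective (fun x : shiftSubgroup a D j => (⟨(a ^ j) x, x.2⟩ : D)) fun _ _ h =>
    Subtype.ext ((a ^ j).injective (congrArg Subtype.val h))

lemma shiftSubgroup_zero : shiftSubgroup a D 0 = D := by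
  ext x; simp [mem_shiftSubgroup]

lemma zpow_mem_shiftSubgroup {j n : ℤ} {x : G} : (a ^ n) x ∈ shiftSubgroup a D j ↔
    x ∈ shiftSubgroup a D (j + n) := by
  rw [mem_shiftSubgroup, mem_shiftSubgroup, zpow_add_aut_apply]

lemma shiftSubgroup_le_window {l : ℕ} (hD : D ≤ window a N (Set.Iio 0 ∪ Set.Ici ((l + 1 : ℕ) : ℤ)))
    {j : ℤ} {T : Set ℤ} (hT : ∀ n ∈ T, n < j ∨ j + l < n) : shiftSubgroup a D j ≤ window a N T := by
  intro x hx
  refine mem_window.2 fun n hn => ?_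
  have : (a ^ (n - j)) ((a ^ j) x) ∈ N := mem_window.1 (hD hx) (n - j) (by
    simp only [Set.mem_union, Set.mem_Iio, Set.mem_Ici]
    have := hT n hn
    omega)
  rwa [← zpow_add_aut_apply, sub_add_cancel] at this

variable [TopologicalSpace G] [IsTopologicalGroup G]

/-- The closed subgroup generated by the translates of `D` at the positions in `S`. -/
def block (a : MulAut G) (D : Subgroup G) (S : Set ℤ) : Subgroup G :=
  (⨆ j ∈ S, shiftSubgroup a D j).topologicalClosure

lemma block_isClosed (S : Set ℤ) : IsClosed (block a D S : Set G) :=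
  Subgroup.isClosed_topologicalClosure _

lemma shiftSubgroup_le_block {S : Set ℤ} {j : ℤ} (hj : j ∈ S) : shiftSubgroup a D j ≤ block a D S :=
  (le_iSup₂_of_le (f := fun j (_ : j ∈ S) => shiftSubgroup a D j) j hj le_rfl).trans
    (Subgroup.le_topologicalClosure _)

lemma block_le {S : Set ℤ} {H : Subgroup G} (hH : IsClosed (H : Set G))
    (h : ∀ j ∈ S, shiftSubgroup a D j ≤ H) : block a D S ≤ H :=
  Subgroup.topologicalClosure_minimal _ (iSup₂_le h) hH

lemma block_mono {S T : Set ℤ} (h : S ⊆ T) : block a D S ≤ block a D T :=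
  block_le (block_isClosed _) fun _ hj => shiftSubgroup_le_block (h hj)

instance block_normal [D.Normal] (S : Set ℤ) : (block a D S).Normal := by
  have : (⨆ j ∈ S, shiftSubgroup a D j).Normal := by
    rw [iSup_subtype']
    exact Subgroup.iSup_normal _
  exact Subgroup.is_normal_topologicalClosure _

lemma zpow_mem_block (ha : ∀ n : ℤ, Continuous (a ^ n)) {S T : Set ℤ} {n : ℤ} {x : G}
    (hx : x ∈ block a D S) (h : ∀ j ∈ S, j - n ∈ T) : (a ^ n) x ∈ block a D T := by
  have : block a D S ≤ (block a D T).comap (a ^ n).toMonoidHom := by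
    refine block_le ((block_isClosed T).preimage (ha n)) fun j hj y hy => ?_
    refine shiftSubgroup_le_block (h j hj) (zpow_mem_shiftSubgroup.2 ?_)
    rwa [sub_add_cancel]
  exact this hx

lemma block_singleton [T2Space G] [Finite D] (j : ℤ) : block a D {j} = shiftSubgroup a D j :=
  have hfin : (shiftSubgroup a D j : Set G).Finite := shiftSubgroup_finite j
  le_antisymm (block_le hfin.isClosed fun i hi => by rw [Set.mem_singleton_iff.1 hi])
    (shiftSubgroup_le_block rfl)

lemma exists_mul_of_mem_block_union [CompactSpace G] [T2Space G] [D.Normal] {S T : Set ℤ} {x : G}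
    (hx : x ∈ block a D (S ∪ T)) : ∃ u ∈ block a D S, ∃ v ∈ block a D T, u * v = x := by
  have hcl : IsClosed ((block a D S ⊔ block a D T : Subgroup G) : Set G) := by
    rw [Subgroup.mul_normal]
    exact ((block_isClosed S).isCompact.mul (block_isClosed T).isCompact).isClosed
  have : x ∈ block a D S ⊔ block a D T := block_le hcl (fun j hj => by
    rcases hj with hj | hj
    · exact (shiftSubgroup_le_block hj).trans le_sup_left
    · exact (shiftSubgroup_le_block hj).trans le_sup_right) hx
  rw [← SetLike.mem_coe, Subgroup.mul_normal] at this
  exact Set.mem_mul.1 this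

lemma block_le_window (ha : ∀ n : ℤ, Continuous (a ^ n)) (hN : IsClosed (N : Set G)) {l : ℕ}
    (hD : D ≤ window a N (Set.Iio 0 ∪ Set.Ici ((l + 1 : ℕ) : ℤ)))
    {S T : Set ℤ} (hST : ∀ j ∈ S, ∀ n ∈ T, n < j ∨ j + l < n) : block a D S ≤ window a N T :=
  block_le (window_isClosed ha hN _) fun j hj => shiftSubgroup_le_window hD (hST j hj)

/-- Minimality of the support length `l + 1` makes past and future blocks independent. -/
lemma eq_one_of_mem_block_Iio_Ici (ha : ∀ n : ℤ, Continuous (a ^ n)) (hN : IsClosed (N : Set G))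
    {l : ℕ} (hD : D ≤ window a N (Set.Iio 0 ∪ Set.Ici ((l + 1 : ℕ) : ℤ)))
    (hl : window a N (Set.Iio 0 ∪ Set.Ici (l : ℤ)) = ⊥) {m : ℤ} {x : G}
    (h1 : x ∈ block a D (Set.Iio m)) (h2 : x ∈ block a D (Set.Ici m)) : x = 1 := by
  have h3 := block_le_window ha hN hD (T := Set.Ici (m + l)) (fun j hj n hn => by
    simp only [Set.mem_Iio, Set.mem_Ici] at hj hn
    omega) h1
  have h4 := block_le_window ha hN hD (T := Set.Iio m) (fun j hj n hn => by
    simp only [Set.mem_Iio, Set.mem_Ici] at hj hn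
    omega) h2
  have h5 := window_eq_bot_of_shift (T := Set.Iio m ∪ Set.Ici (m + l)) m hl fun n hn => by
    simp only [Set.mem_union, Set.mem_Iio, Set.mem_Ici] at hn ⊢
    omega
  refine (Subgroup.eq_bot_iff_forall _).1 h5 x (mem_window.2 fun n hn => ?_)
  rcases hn with hn | hn
  · exact mem_window.1 h4 n hn
  · exact mem_window.1 h3 n hn

variable [T2Space G] [D.Normal]

/-- A minimal normal subgroup that is complemented by the block of its other translates is
simple. -/
lemma isSimpleGroup_of_minimal [Finite D] (hne : D ≠ ⊥)
    (hmin : ∀ H : Subgroup G, H.Normal → H ≤ D → H ≠ ⊥ → H = D)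
    (hdisj : ∀ x ∈ block a D {0}ᶜ, x ∈ D → x = 1) (htop : block a D Set.univ = ⊤) :
    IsSimpleGroup D := by
  have : Nontrivial D := (Subgroup.nontrivial_iff_ne_bot D).2 hne
  refine ⟨fun H hH => ?_⟩
  have hle : H.map D.subtype ≤ D := Subgroup.map_subtype_le H
  have hfin : Finite (H.map D.subtype) := Finite.of_injective _ (Subgroup.inclusion_injective hle)
  have hcl : IsClosed (H.map D.subtype : Set G) := (Set.toFinite _).isClosed
  have hnorm : (H.map D.subtype).Normal := by
    -- The normalizer is closed and contains every translate of `D`: `D` itself because `H` is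
    -- normal in it, the others because they commute with `D`. So it is all of `G`, and minimality
    -- of `D` applies.
    let K : Subgroup G := Subgroup.normalizer (H.map D.subtype : Set G)
    have hKcl : IsClosed (K : Set G) := by
      have : (K : Set G) = ⋂ h : (H.map D.subtype),
          {g | g * (h : G) * g⁻¹ ∈ (H.map D.subtype : Set G)} ∩
            {g | g⁻¹ * (h : G) * g ∈ (H.map D.subtype : Set G)} := by
        ext g
        simp only [Set.mem_iInter]
        refine ⟨fun hg h => ⟨(Subgroup.mem_normalizer_iff.1 hg _).1 h.2, ?_⟩, fun hg => ?_⟩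
        · exact (Subgroup.mem_normalizer_iff''.1 hg _).1 h.2
        · refine Subgroup.mem_normalizer_iff.2 fun h => ⟨fun hh => (hg ⟨h, hh⟩).1, fun hh => ?_⟩
          have := (hg ⟨_, hh⟩).2
          simpa [mul_assoc] using this
      rw [this]
      exact isClosed_iInter fun h => (hcl.preimage (by fun_prop)).inter
        (hcl.preimage (by fun_prop))
    have hKtop : K = ⊤ := by
      rw [eq_top_iff, ← htop]
      refine block_le hKcl fun j _ g hg => ?_
      have hconj : ∀ g ∈ shiftSubgroup a D j, ∀ h ∈ H.map D.subtype,
          g * h * g⁻¹ ∈ H.map D.subtype := by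
        intro g hg h hh
        by_cases hj : j = 0
        · subst hj
          rw [shiftSubgroup_zero] at hg
          obtain ⟨h, hh, rfl⟩ := hh
          exact ⟨⟨g, hg⟩ * h * ⟨g, hg⟩⁻¹, hH.conj_mem h hh _, rfl⟩
        · have hcomm := Subgroup.commute_of_normal_of_disjoint (shiftSubgroup a D j) D
            inferInstance inferInstance (Subgroup.disjoint_def.2 fun hx hxD =>
              hdisj _ (shiftSubgroup_le_block (by simpa using hj) hx) hxD) g h hg (hle hh)
          rwa [hcomm.eq, mul_inv_cancel_right]
      refine Subgroup.mem_normalizer_iff.2 fun h => ⟨hconj g hg h, fun hh => ?_⟩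
      simpa [mul_assoc] using hconj g⁻¹ (inv_mem hg) _ hh
    exact Subgroup.normalizer_eq_top_iff.1 hKtop
  by_cases hb : H.map D.subtype = ⊥
  · left
    exact (Subgroup.map_eq_bot_iff_of_injective _ D.subtype_injective).1 hb
  · right
    have := hmin _ hnorm hle hb
    refine eq_top_iff.2 fun x _ => ?_
    have hx : (x : G) ∈ H.map D.subtype := by rw [this]; exact x.2
    obtain ⟨y, hy, hyx⟩ := hx
    rwa [← Subtype.ext hyx]

variable [CompactSpace G]

/-- Split the complement of `m` into past and future, and apply past–future independence at `m` to
kill the past factor, then at `m + 1` to kill the rest. -/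
lemma eq_one_of_mem_block_compl_of_mem_shiftSubgroup (ha : ∀ n : ℤ, Continuous (a ^ n))
    (hN : IsClosed (N : Set G))
    {l : ℕ} (hD : D ≤ window a N (Set.Iio 0 ∪ Set.Ici ((l + 1 : ℕ) : ℤ)))
    (hl : window a N (Set.Iio 0 ∪ Set.Ici (l : ℤ)) = ⊥) {m : ℤ} {x : G}
    (h1 : x ∈ block a D {m}ᶜ) (h2 : x ∈ shiftSubgroup a D m) : x = 1 := by
  rw [show ({m}ᶜ : Set ℤ) = Set.Iio m ∪ Set.Ioi m by ext; simp] at h1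
  obtain ⟨u, hu, v, hv, rfl⟩ := exists_mul_of_mem_block_union h1
  have hv' := block_mono (a := a) (D := D) (S := Set.Ioi m) (T := Set.Ici m)
    Set.Ioi_subset_Ici_self hv
  have hu1 : u = 1 := eq_one_of_mem_block_Iio_Ici ha hN hD hl hu (by
    have := mul_mem (shiftSubgroup_le_block (S := Set.Ici m) (Set.mem_Ici.2 le_rfl) h2) (inv_mem hv')
    simpa using this)
  subst hu1
  rw [one_mul] at h2 ⊢
  refine eq_one_of_mem_block_Iio_Ici ha hN hD hl (m := m + 1)
    (shiftSubgroup_le_block (by simp) h2) (block_mono (fun j hj => ?_) hv)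
  simp only [Set.mem_Ici, Set.mem_Ioi] at hj ⊢
  omega

lemma mem_block_compl_of_forall [Finite D] (ha : ∀ n : ℤ, Continuous (a ^ n))
    (hN : IsClosed (N : Set G))
    {l : ℕ} (hD : D ≤ window a N (Set.Iio 0 ∪ Set.Ici ((l + 1 : ℕ) : ℤ)))
    (hl : window a N (Set.Iio 0 ∪ Set.Ici (l : ℤ)) = ⊥) (htop : block a D Set.univ = ⊤) {x : G}
    (hx : ∀ m : ℤ, x ∈ block a D {m}ᶜ) (s : Finset ℤ) : x ∈ block a D (s : Set ℤ)ᶜ := by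
  classical
  induction s using Finset.induction_on with
  | empty => simp [htop]
  | insert m s hm ih =>
    have hsplit : ((s : Set ℤ)ᶜ) = ((insert m s : Finset ℤ) : Set ℤ)ᶜ ∪ {m} := by
      ext j
      by_cases hj : j = m
      · subst hj; simpa using hm
      · simp [hj]
    rw [hsplit] at ih
    obtain ⟨u, hu, v, hv, rfl⟩ := exists_mul_of_mem_block_union ih
    have hu' : u ∈ block a D {m}ᶜ := block_mono (fun j hj => by
      simp only [Finset.coe_insert, Set.mem_compl_iff, Set.mem_insert_iff, not_or] at hj
      exact hj.1) hu
    have hv1 : v = 1 := eq_one_of_mem_block_compl_of_mem_shiftSubgroup ha hN hD hl (m := m)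
      (by simpa using mul_mem (inv_mem hu') (hx m)) (by rwa [block_singleton] at hv)
    rwa [hv1, mul_one]

/-- Only the translates at positions in `[n - l, n]` reach coordinate `n`. Removing these finitely
many makes coordinate `n` trivial, and expansiveness concludes. -/
lemma eq_one_of_forall_mem_block_compl [Finite D] (ha : ∀ n : ℤ, Continuous (a ^ n))
    (hN : IsClosed (N : Set G)) (hexp : window a N Set.univ = ⊥)
    {l : ℕ} (hD : D ≤ window a N (Set.Iio 0 ∪ Set.Ici ((l + 1 : ℕ) : ℤ)))
    (hl : window a N (Set.Iio 0 ∪ Set.Ici (l : ℤ)) = ⊥) (htop : block a D Set.univ = ⊤) {x : G}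
    (hx : ∀ m : ℤ, x ∈ block a D {m}ᶜ) : x = 1 := by
  refine (Subgroup.eq_bot_iff_forall _).1 hexp x (mem_window.2 fun n _ => ?_)
  have h := mem_block_compl_of_forall ha hN hD hl htop hx (Finset.Icc (n - l) n)
  refine mem_window.1 (block_le_window ha hN hD (T := {n}) (fun j hj i hi => ?_) h) n rfl
  rw [Set.mem_singleton_iff.1 hi]
  simp only [Finset.coe_Icc, Set.mem_compl_iff, Set.mem_Icc] at hj
  omega

end Block

/-! ### Identification of `G` with a full shift. -/

section Classification

variable {G : Type*} [Group G]

lemma exists_minimal_normal {E : Subgroup G} [Finite E] [E.Normal] (hE : E ≠ ⊥) :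
    ∃ D : Subgroup G, D.Normal ∧ D ≤ E ∧ D ≠ ⊥ ∧
      ∀ H : Subgroup G, H.Normal → H ≤ D → H ≠ ⊥ → H = D := by
  obtain ⟨D, ⟨hn, hle, hne⟩, hmin⟩ := WellFounded.has_min
    (InvImage.wf (fun H : Subgroup G => Nat.card H) Nat.lt_wfRel.wf)
    {H : Subgroup G | H.Normal ∧ H ≤ E ∧ H ≠ ⊥} ⟨E, ‹_›, le_rfl, hE⟩
  refine ⟨D, hn, hle, hne, fun H hH hHD hHne => ?_⟩
  have : Finite D := Finite.of_injective _ (Subgroup.inclusion_injective hle)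
  exact Subgroup.eq_of_le_of_card_ge hHD (not_lt.1 (hmin H ⟨hH, hHD.trans hle, hHne⟩))

variable [TopologicalSpace G] [IsTopologicalGroup G] [CompactSpace G] {a : MulAut G}
  {N D : Subgroup G}

/-- By expansiveness, elements supported in `[0, k)` are separated by the finite quotient by the
window on `[0, k)`. -/
lemma window_finite (ha : ∀ n : ℤ, Continuous (a ^ n)) (hN : IsOpen (N : Set G))
    (hexp : window a N Set.univ = ⊥) (k : ℤ) :
    Finite (window a N (Set.Iio 0 ∪ Set.Ici k)) := by
  have : Finite (G ⧸ window a N (Set.Ico 0 k)) :=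
    Subgroup.quotient_finite_of_isOpen _ (window_isOpen ha hN (Set.finite_Ico _ _))
  refine Finite.of_injective (fun x : window a N (Set.Iio 0 ∪ Set.Ici k) =>
    ((x : G) : G ⧸ window a N (Set.Ico 0 k))) fun x y hxy => ?_
  have h1 := QuotientGroup.eq.1 hxy
  have h2 := mul_mem (inv_mem x.2) y.2
  have h3 : (x : G)⁻¹ * y = 1 := by
    refine (Subgroup.eq_bot_iff_forall _).1 hexp _ (mem_window.2 fun n _ => ?_)
    by_cases hn : n ∈ Set.Ico 0 k
    · exact mem_window.1 h1 n hn
    · refine mem_window.1 h2 n ?_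
      simp only [Set.mem_Ico, Set.mem_union, Set.mem_Iio, Set.mem_Ici] at hn ⊢
      omega
  exact Subtype.ext (inv_mul_eq_one.1 h3)

variable [T2Space G]

/-- A finite normal subgroup `D` that is complemented by the block of its other translates is a
quotient of `G`, with kernel that block. -/
lemma exists_projection [D.Normal] [Finite D]
    (hdisj : ∀ x ∈ block a D {0}ᶜ, x ∈ D → x = 1) (htop : block a D Set.univ = ⊤) :
    ∃ π : G →* D, (∀ x, π x = 1 ↔ x ∈ block a D {0}ᶜ) ∧ (∀ d : D, π d = d) ∧
      IsOpen (π.ker : Set G) := by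
  let f : D →* G ⧸ block a D {0}ᶜ := (QuotientGroup.mk' _).comp D.subtype
  have hf : Function.Bijective f := by
    refine ⟨(injective_iff_map_eq_one f).2 fun d hd => Subtype.ext (hdisj d ?_ d.2), fun q => ?_⟩
    · exact (QuotientGroup.eq_one_iff _).1 hd
    · obtain ⟨x, rfl⟩ := QuotientGroup.mk_surjective q
      have hx : x ∈ block a D ({0} ∪ {0}ᶜ) := by
        rw [Set.union_compl_self, htop]; trivial
      obtain ⟨u, hu, v, hv, rfl⟩ := exists_mul_of_mem_block_union hx
      rw [block_singleton, shiftSubgroup_zero] at hu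
      refine ⟨⟨u, hu⟩, QuotientGroup.eq.2 ?_⟩
      simpa using hv
  let e := MulEquiv.ofBijective f hf
  have hker : ∀ x, (e.symm.toMonoidHom.comp (QuotientGroup.mk' (block a D {0}ᶜ))) x = 1 ↔
      x ∈ block a D {0}ᶜ := fun x => by
    rw [← QuotientGroup.eq_one_iff]
    exact e.symm.map_eq_one_iff
  refine ⟨e.symm.toMonoidHom.comp (QuotientGroup.mk' _), hker, fun d => e.symm_apply_apply d, ?_⟩
  have : Finite (G ⧸ block a D {0}ᶜ) := Finite.of_equiv D e.toEquiv
  have : (block a D {0}ᶜ).FiniteIndex := Subgroup.finiteIndex_of_finite_quotient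
  convert Subgroup.isOpen_of_isClosed_of_finiteIndex _ (block_isClosed (a := a) (D := D) {0}ᶜ)
    using 1
  ext x
  exact hker x

omit [T2Space G] in
-- The isomorphism sends `x` to the sequence `π ((a ^ n) x)`.
lemma pairIso_shiftAut_of_projection [D.Normal] [Finite D] (α : G ≃ₜ* G)
    (ha : ∀ n : ℤ, Continuous ((α.toMulEquiv : MulAut G) ^ n))
    (hinj : ∀ x : G, (∀ m : ℤ, x ∈ block (α.toMulEquiv : MulAut G) D {m}ᶜ) → x = 1)
    {F : Type*} [Group F] [TopologicalSpace F] [DiscreteTopology F]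
    (π : G →* F) (hπ : ∀ x, π x = 1 ↔ x ∈ block (α.toMulEquiv : MulAut G) D {0}ᶜ)
    (hsurj : ∀ f : F, ∃ d ∈ D, π d = f) (hopen : IsOpen (π.ker : Set G)) :
    PairIso α (shiftAut F) := by
  classical
  set a : MulAut G := α.toMulEquiv with hadef
  have hcont : Continuous π := by
    refine continuous_of_continuousAt_one π ?_
    rw [ContinuousAt, map_one π, nhds_discrete F]
    exact Filter.tendsto_pure.2 (hopen.mem_nhds (one_mem π.ker))
  let φ : G →* (ℤ → F) := MonoidHom.pi fun n => π.comp (a ^ n).toMonoidHom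
  have hφ : ∀ x n, φ x n = π ((a ^ n) x) := fun _ _ => rfl
  have hφc : Continuous φ := continuous_pi fun n => hcont.comp (ha n)
  have hφi : Function.Injective φ := by
    refine (injective_iff_map_eq_one φ).2 fun x hx => hinj x fun m => ?_
    have h1 : π ((a ^ m) x) = 1 := congrFun hx m
    have h2 := zpow_mem_block (T := {m}ᶜ) (n := -m) ha ((hπ _).1 h1) fun j hj => by
      simp only [Set.mem_compl_iff, Set.mem_singleton_iff] at hj ⊢
      omega
    rwa [zpow_neg_zpow_apply] at h2
  have hfin : ∀ (g : ℤ → F) (s : Finset ℤ), ∃ x, ∀ m ∈ s, φ x m = g m := by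
    intro g s
    induction s using Finset.induction_on with
    | empty => simp
    | insert m s hm ih =>
      obtain ⟨x, hx⟩ := ih
      obtain ⟨d, hd, hdf⟩ := hsurj ((φ x m)⁻¹ * g m)
      -- The factor `(a ^ (-m)) d` changes coordinate `m` only, since `π` kills the other translates
      -- of `D`.
      refine ⟨x * (a ^ (-m)) d, fun j hj => ?_⟩
      rw [map_mul, Pi.mul_apply, hφ ((a ^ (-m)) d)]
      by_cases hjm : j = m
      · subst hjm
        rw [zpow_zpow_neg_apply, hdf, mul_inv_cancel_left]
      · have hd' : d ∈ shiftSubgroup a D 0 := by rwa [shiftSubgroup_zero]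
        have h1 : (a ^ (j + -m)) d ∈ block a D {0}ᶜ :=
          zpow_mem_block ha (S := {0}) (shiftSubgroup_le_block (Set.mem_singleton 0) hd') (by
            intro i hi
            rw [Set.mem_singleton_iff] at hi
            simp only [Set.mem_compl_iff, Set.mem_singleton_iff]
            omega)
        rw [zpow_add_aut_apply] at h1
        rw [(hπ _).2 h1, mul_one]
        exact hx j (Finset.mem_of_mem_insert_of_ne hj hjm)
  have hφs : Function.Surjective φ := by
    intro g
    obtain ⟨x, hx⟩ := CompactSpace.iInter_nonempty (t := fun m : ℤ => {x | φ x m = g m})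
      (fun m => isClosed_eq ((continuous_apply m).comp hφc) continuous_const) fun s => by
        obtain ⟨x, hx⟩ := hfin g s
        exact ⟨x, Set.mem_iInter₂.2 hx⟩
    exact ⟨x, funext fun m => Set.mem_iInter.1 hx m⟩
  let e : G ≃ (ℤ → F) := Equiv.ofBijective φ ⟨hφi, hφs⟩
  have he : Continuous e := hφc
  refine ⟨ContinuousMulEquiv.mk' (Continuous.homeoOfEquivCompactToT2 he)
    fun x y => map_mul φ x y, fun x => funext fun n => ?_⟩
  change π ((a ^ n) (a x)) = π ((a ^ (n + 1)) x)
  rw [zpow_add_aut_apply, zpow_one]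

omit [IsTopologicalGroup G] [CompactSpace G] [T2Space G] in
lemma continuous_zpow_toMulEquiv (α : G ≃ₜ* G) (n : ℤ) :
    Continuous ((α.toMulEquiv : MulAut G) ^ n) := by
  induction n using Int.induction_on with
  | zero => exact continuous_id
  | succ i ih =>
    rw [zpow_add_one]
    exact ih.comp α.continuous
  | pred i ih =>
    rw [zpow_sub_one]
    exact ih.comp α.symm.continuous

lemma exists_pairIso_shiftAut [TotallyDisconnectedSpace G] (α : G ≃ₜ* G)
    (hα : IsIrreduciblePair α) :
    ∃ (F : Type) (_ : Group F) (_ : TopologicalSpace F),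
      DiscreteTopology F ∧ Finite F ∧ IsSimpleGroup F ∧ PairIso α (shiftAut F) := by
  obtain ⟨hinf, hirr⟩ := hα
  have ha := continuous_zpow_toMulEquiv α
  set a : MulAut G := α.toMulEquiv with hadef
  replace hirr : ∀ H : Subgroup G, H ≠ ⊤ → IsClosed (H : Set G) → H.Normal →
      (∀ x, a x ∈ H ↔ x ∈ H) → (H : Set G).Finite := by
    refine fun H hne hcl hn hst => hirr H hne hcl hn (Set.ext fun y => ⟨?_, fun hy => ?_⟩)
    · rintro ⟨x, hx, rfl⟩
      exact (hst x).2 hx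
    · exact ⟨α.symm y, (hst _).1 (by
        change α (α.symm y) ∈ H
        rwa [α.apply_symm_apply]), α.apply_symm_apply y⟩
  obtain ⟨N, hNn, hNo, hexp⟩ := exists_expansive_openNormal ha hirr
  have hNc := N.isClosed_of_isOpen hNo
  have hfull : ∀ H : Subgroup G, IsClosed (H : Set G) → H.Normal → (∀ x, a x ∈ H ↔ x ∈ H) →
      ∀ x ∈ H, x ≠ 1 → ∀ m, x ∈ window a N (Set.Ici m) → H = ⊤ := by
    intro H hcl hn hst x hx hx1 m hm
    by_contra hne
    exact not_finite_of_mem_window_Ici hexp hst hx hx1 hm (hirr H hne hcl hn hst)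
  have hex := exists_window_ne_bot ha hNo hexp hfull
  classical
  have hspec := Nat.find_spec hex
  have hmin := fun m => Nat.find_min (H := hex) (m := m)
  generalize Nat.find hex = k at hspec hmin
  -- Support length `0` is excluded by expansiveness.
  obtain _ | l := k
  · refine absurd ?_ hspec
    rw [← hexp]
    congr 1
    ext n
    simp
  have hl := not_not.1 (hmin l (Nat.lt_succ_self l))
  have := window_finite ha hNo hexp ((l + 1 : ℕ) : ℤ)
  have := window_normal (a := a) (N := N) (Set.Iio 0 ∪ Set.Ici ((l + 1 : ℕ) : ℤ))
  obtain ⟨D, hDn, hD, hDne, hDmin⟩ := exists_minimal_normal hspec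
  have : Finite D := Finite.of_injective _ (Subgroup.inclusion_injective hD)
  have htop : block a D Set.univ = ⊤ := by
    obtain ⟨d, hd, hd1⟩ := D.bot_or_exists_ne_one.resolve_left hDne
    refine hfull _ (block_isClosed _) (block_normal _) (fun x => ⟨fun h => ?_, fun h => ?_⟩) d
      (shiftSubgroup_le_block (Set.mem_univ 0) (by rwa [shiftSubgroup_zero])) hd1 ((l + 1 : ℕ) : ℤ)
      (window_anti Set.subset_union_right (hD hd))
    · simpa using zpow_mem_block (T := Set.univ) (n := -1) ha h (by simp)
    · simpa using zpow_mem_block (T := Set.univ) (n := 1) ha h (by simp)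
  have hdisj : ∀ x ∈ block a D {0}ᶜ, x ∈ D → x = 1 := fun x hx hxD =>
    eq_one_of_mem_block_compl_of_mem_shiftSubgroup ha hNc hD hl hx (by rwa [shiftSubgroup_zero])
  have hsimple := isSimpleGroup_of_minimal hDne hDmin hdisj htop
  obtain ⟨π, hπ, hπD, hπo⟩ := exists_projection hdisj htop
  -- `D` lives in the universe of `G`; finiteness provides a copy in `Type`.
  obtain ⟨F, hF, hFfin, ⟨e⟩⟩ := Finite.exists_type_univ_nonempty_mulEquiv.{_, 0} D
  let tF : TopologicalSpace F := ⊥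
  have hdF : DiscreteTopology F := ⟨rfl⟩
  refine ⟨F, hF, tF, hdF, inferInstance, e.symm.isSimpleGroup, ?_⟩
  refine pairIso_shiftAut_of_projection α ha
    (fun x hx => eq_one_of_forall_mem_block_compl ha hNc hexp hD hl htop hx)
    (e.toMonoidHom.comp π) (fun x => ?_) (fun f => ?_) ?_
  · rw [← hπ]
    exact e.map_eq_one_iff
  · exact ⟨e.symm f, (e.symm f).2, by simp [hπD]⟩
  · convert hπo using 1
    ext x
    exact e.map_eq_one_iff

end Classification

theorem proposition6p8 {G : Type*} [Group G] [TopologicalSpace G] [IsTopologicalGroup G]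
    [CompactSpace G] [T2Space G] [TotallyDisconnectedSpace G] (α : G ≃ₜ* G) :
    IsIrreduciblePair α ↔
      ∃ (F : Type) (_ : Group F) (_ : TopologicalSpace F),
        DiscreteTopology F ∧ Finite F ∧ IsSimpleGroup F ∧ PairIso α (shiftAut F) := by
  refine ⟨exists_pairIso_shiftAut α, ?_⟩
  rintro ⟨F, _, _, _, _, _, h⟩
  exact isIrreduciblePair_shiftAut.of_pairIso h
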